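/- Let $A_1,S\in\mathbb{R}^{N\times N}$, let $b$ and $c$ be real input and output vectors, $k$ a real row vector of feedback gains, and $\xi$ a real parameter with nominal value $\xi_0$. Put $A(\xi)=A_1-bk+\xi S$ and $A_0=A(\xi_0)$. Let $\beta$ satisfy $A_0\beta=b$ (so $\beta=A_0^{-1}b$ if $A_0$ is invertible), assume $c\beta\neq 0$, and put $k_0=-(c\beta)^{-1}$. The tracking error of the zero-state unit step response, with $k_0$ and $\beta$ held at their nominal values, is $e(\xi,t)=-k_0\,c\,e^{A(\xi)t}\beta$, and its log-sensitivity is $$s(\xi_0,t)=\frac{\partial e(\xi,t)}{\partial \xi}\,\frac{\xi}{e(\xi,t)}\Big|_{\xi=\xi_0}.$$ Suppose that $\lambda_1$ is an eigenvalue of $A_0$ of algebraic multiplicity $\ell$ and geometric multiplicity $1$, and that it is dominant: $\operatorname{Re}\mu<\operatorname{Re}\lambda_1$ for every other eigenvalue $\mu$ of $A_0$. Let $A_0=MJM^{-1}$ be any Jordan decomposition over $\mathbb{C}$ (ones on the superdiagonal of the blocks) in which the Jordan block of $\lambda_1$ comes first, and put $z=cM$, $w=M^{-1}\beta$, $\bar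 S=M^{-1}SM$. Assume $z_1w_\ell\neq 0$. Then $e(\xi,t)$ is differentiable in $\xi$ at $\xi_0$ for every $t$, $e(\xi_0,t)\ne 0$ for all sufficiently large $t$, and there are constants $f_0,\dots,f_\ell\in\mathbb{C}$ such that $$s(\xi_0,t)=\xi_0F(t)+R(t),\qquad F(t)=\Big(\sum_{n=0}^{\ell}f_n t^n\Big)\Big/\Big(\frac{z_1w_\ell}{(\ell-1)!}\Big),$$ where $R(t)\to 0$ as $t\to\infty$, more precisely $R(t)=O(t^{-1})$. The leading coefficient is $f_\ell=z_1w_\ell\,\bar s_{\ell 1}/(2\ell-1)!$. If $\xi_0\neq 0$ and $f_n\neq 0$ for some $n\ge 1$, then $|s(\xi_0,t)|\to\infty$ as $t\to\infty$; thus $s(\xi_0,t)$ diverges like a polynomial in $t$. -/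

import Mathlib

open Filter Topology Asymptotics

/-- Data of a single-input single-output system with uncertain parameter `ξ`, nominal value `ξ₀`:
open-loop matrix `A₁ + ξ S`, input vector `b`, output vector `c`, static feedback gains `k`. -/
structure SISOSystem (N : ℕ) where
  A₁ : Matrix (Fin N) (Fin N) ℝ
  S : Matrix (Fin N) (Fin N) ℝ
  b : Fin N → ℝ
  c : Fin N → ℝ
  k : Fin N → ℝ
  ξ₀ : ℝ

namespace SISOSystem

variable {N : ℕ} (P : SISOSystem N)

/-- The closed-loop matrix `A(ξ) = A₁ - b k + ξ S`. -/
def A (ξ : ℝ) : Matrix (Fin N) (Fin N) ℝ :=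
  P.A₁ - Matrix.vecMulVec P.b P.k + ξ • P.S

/-- The nominal closed-loop matrix `A₀ = A(ξ₀)`. -/
def A₀ : Matrix (Fin N) (Fin N) ℝ := P.A P.ξ₀

/-- The nominal closed-loop matrix, seen as a complex matrix. -/
def A₀C : Matrix (Fin N) (Fin N) ℂ := P.A₀.map Complex.ofReal

/-- The reference gain `k₀ = -(c β)⁻¹`, where `A₀ β = b`. -/
noncomputable def k₀ (β : Fin N → ℝ) : ℝ := -(P.c ⬝ᵥ β)⁻¹

/-- The tracking error `-k₀ c exp(A(ξ) t) β` of the zero-state response to the unit step,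
where `k₀` and `β` are kept at their nominal values. -/
noncomputable def err (β : Fin N → ℝ) (ξ t : ℝ) : ℝ :=
  -P.k₀ β * (P.c ⬝ᵥ (NormedSpace.exp (t • P.A ξ)).mulVec β)

/-- The log-sensitivity `s(ξ₀, t) = (∂e(t)/∂ξ) · ξ / e(t)` at `ξ = ξ₀`. -/
noncomputable def logSens (β : Fin N → ℝ) (t : ℝ) : ℝ :=
  deriv (fun ξ => P.err β ξ t) P.ξ₀ * (P.ξ₀ / P.err β P.ξ₀ t)

/-- The row vector `z = c M`. -/
noncomputable def z (M : Matrix (Fin N) (Fin N) ℂ) : Fin N → ℂ :=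
  Matrix.vecMul (fun i => (P.c i : ℂ)) M

/-- The matrix `M⁻¹ S M`. -/
noncomputable def Sbar (M : Matrix (Fin N) (Fin N) ℂ) : Matrix (Fin N) (Fin N) ℂ :=
  M⁻¹ * P.S.map Complex.ofReal * M

end SISOSystem

/-- The column vector `w = M⁻¹ β`. -/
noncomputable def modalVec {N : ℕ} (M : Matrix (Fin N) (Fin N) ℂ) (β : Fin N → ℝ) : Fin N → ℂ :=
  M⁻¹.mulVec (fun i => (β i : ℂ))

/-- `J` is a direct sum of (upper) Jordan blocks: it vanishes off the diagonal and the
superdiagonal, and each superdiagonal entry is `0`, or is `1` between two equal diagonal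
entries. -/
def IsJordanMatrix {N : ℕ} (J : Matrix (Fin N) (Fin N) ℂ) : Prop :=
  ∀ i j : Fin N,
    (i ≠ j → (i : ℕ) + 1 ≠ (j : ℕ) → J i j = 0) ∧
    ((i : ℕ) + 1 = (j : ℕ) → J i j = 0 ∨ (J i j = 1 ∧ J i i = J j j))

/-! The log-sensitivity is `ξ₀` times the quotient of the `ξ`-derivative of `c exp(A(ξ) t) β` by its
nominal value; `k₀` cancels, and both terms may be multiplied by `exp(-lam t)`. The scaled terms are
polynomials in `t` up to exponentially decaying errors, a class (`PolyUpToDecay`) that also records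
the coefficient of the top normalised monomial `tⁿ / n!`.

In Jordan coordinates the scaled `exp(t J) w` solves a triangular system: the first block is
nilpotent and the other rows are stable by dominance. Its entries thus have degree at most `ℓ - 1`,
attained only by the first row, with coefficient `w_ℓ` (`PolyUpToDecay.of_chain`). Hence the output
has top coefficient `z_1 w_ℓ ≠ 0` in degree `ℓ - 1`.

By Duhamel's formula the derivative is a sum of convolutions of entries of `z exp(s J)` and `exp(t
J) w`, weighted by the entries of `Sbar`. Convolution adds degrees plus one and multiplies
normalised top coefficients (`PolyUpToDecay.halfConv`), so degree `2 ℓ - 1` comes only from the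
entry `(ℓ, 1)` of `Sbar`. Euclidean division of the two polynomials then gives a quotient of degree
at most `ℓ`, and everything else is `O(t⁻¹)` (`PolyUpToDecay.exists_quotient`). -/

/-- `f` decays exponentially on `[0, ∞)`. -/
def ExpDecay (f : ℝ → ℂ) : Prop :=
  ∃ C δ : ℝ, 0 < δ ∧ ∀ t : ℝ, 0 ≤ t → ‖f t‖ ≤ C * Real.exp (-δ * t)

/-- The convolution `∫₀ᵗ f (t - τ) g τ dτ`. -/
noncomputable def halfConv (f g : ℝ → ℂ) (t : ℝ) : ℂ :=
  ∫ τ in (0 : ℝ)..t, f (t - τ) * g τ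

/-! ### Closure properties of exponential decay. -/

namespace ExpDecay

variable {f g : ℝ → ℂ}

theorem zero : ExpDecay (fun _ => 0) :=
  ⟨0, 1, one_pos, fun t _ => by simp⟩

theorem exists_common (hf : ExpDecay f) (hg : ExpDecay g) :
    ∃ C D δ : ℝ, 0 ≤ C ∧ 0 ≤ D ∧ 0 < δ ∧ ∀ t : ℝ, 0 ≤ t →
      ‖f t‖ ≤ C * Real.exp (-δ * t) ∧ ‖g t‖ ≤ D * Real.exp (-δ * t) := by
  obtain ⟨C, δ, hδ, h⟩ := hf
  obtain ⟨D, ε, hε, k⟩ := hg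
  have hC : 0 ≤ C := by simpa using (norm_nonneg _).trans (h 0 le_rfl)
  have hD : 0 ≤ D := by simpa using (norm_nonneg _).trans (k 0 le_rfl)
  refine ⟨C, D, min δ ε, hC, hD, lt_min hδ hε, fun t ht => ⟨(h t ht).trans ?_, (k t ht).trans ?_⟩⟩
  · gcongr
    exact min_le_left _ _
  · gcongr
    exact min_le_right _ _

theorem add (hf : ExpDecay f) (hg : ExpDecay g) : ExpDecay (fun t => f t + g t) := by
  obtain ⟨C, D, δ, -, -, hδ, h⟩ := hf.exists_common hg
  refine ⟨C + D, δ, hδ, fun t ht => (norm_add_le _ _).trans ?_⟩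
  linarith [h t ht]

theorem const_mul (c : ℂ) (hf : ExpDecay f) : ExpDecay (fun t => c * f t) := by
  obtain ⟨C, δ, hδ, h⟩ := hf
  refine ⟨‖c‖ * C, δ, hδ, fun t ht => ?_⟩
  rw [norm_mul, mul_assoc]
  gcongr
  exact h t ht

/-- Half of the decay rate absorbs the factor, since `t ≤ (2 / δ) exp(δ t / 2)`. -/
theorem id_mul (hf : ExpDecay f) : ExpDecay (fun t => (t : ℂ) * f t) := by
  obtain ⟨C, δ, hδ, h⟩ := hf
  have hC : 0 ≤ C := by simpa using (norm_nonneg _).trans (h 0 le_rfl)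
  refine ⟨2 / δ * C, δ / 2, by positivity, fun t ht => ?_⟩
  rw [norm_mul, Complex.norm_real, Real.norm_of_nonneg ht]
  have h1 : t ≤ 2 / δ * Real.exp (δ / 2 * t) := by
    have := Real.add_one_le_exp (δ / 2 * t)
    calc t = 2 / δ * (δ / 2 * t) := by field_simp
      _ ≤ _ := by gcongr; linarith
  calc t * ‖f t‖ ≤ (2 / δ * Real.exp (δ / 2 * t)) * (C * Real.exp (-δ * t)) := by
        gcongr
        exact h t ht
    _ = 2 / δ * C * (Real.exp (δ / 2 * t) * Real.exp (-δ * t)) := by ring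
    _ = _ := by rw [← Real.exp_add]; ring_nf

theorem pow_mul (n : ℕ) (hf : ExpDecay f) : ExpDecay (fun t => (t : ℂ) ^ n * f t) := by
  induction n with
  | zero => simpa using hf
  | succ n ih => simpa [pow_succ', mul_assoc] using ih.id_mul

/-- With a common rate `δ` the integrand is bounded on `[0, t]` by `C D exp(-δ t)`, independently of
`τ`; integration costs only a factor `t`. -/
theorem halfConv (hf : ExpDecay f) (hg : ExpDecay g) : ExpDecay (halfConv f g) := by
  obtain ⟨C, D, δ, hC, hD, hδ, h⟩ := hf.exists_common hg
  have key : ExpDecay (fun t => (t : ℂ) * ((C * D * Real.exp (-δ * t) : ℝ) : ℂ)) := by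
    apply id_mul
    refine ⟨C * D, δ, hδ, fun t _ => ?_⟩
    rw [Complex.norm_real, Real.norm_of_nonneg (by positivity)]
  obtain ⟨B, ε, hε, k⟩ := key
  refine ⟨B, ε, hε, fun t ht => le_trans ?_ (k t ht)⟩
  rw [norm_mul, Complex.norm_real, Complex.norm_real, Real.norm_of_nonneg ht,
    Real.norm_of_nonneg (by positivity), mul_comm]
  have := intervalIntegral.norm_integral_le_of_norm_le_const (a := 0) (b := t)
    (f := fun τ => f (t - τ) * g τ) (C := C * D * Real.exp (-δ * t)) ?_
  · simpa [_root_.halfConv, abs_of_nonneg ht] using this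
  · intro τ hτ
    rw [Set.uIoc_of_le ht] at hτ
    rw [norm_mul]
    calc ‖f (t - τ)‖ * ‖g τ‖ ≤ (C * Real.exp (-δ * (t - τ))) * (D * Real.exp (-δ * τ)) := by
          gcongr
          · exact (h _ (by linarith [hτ.2])).1
          · exact (h _ hτ.1.le).2
      _ = C * D * (Real.exp (-δ * (t - τ)) * Real.exp (-δ * τ)) := by ring
      _ = _ := by rw [← Real.exp_add]; ring_nf

/-- `L` is the integral over the whole half-line, and the tail from `t` on decays at the rate of
`f`. -/
theorem exists_integral_sub (hf : ExpDecay f) (hc : Continuous f) :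
    ∃ L : ℂ, ExpDecay (fun t => (∫ τ in (0 : ℝ)..t, f τ) - L) := by
  obtain ⟨C, δ, hδ, h⟩ := hf
  have hexp : ∀ a : ℝ, MeasureTheory.IntegrableOn
      (fun x : ℝ => C * Real.exp (-δ * x)) (Set.Ioi a) := fun a =>
    (integrableOn_exp_mul_Ioi (neg_lt_zero.2 hδ) a).const_mul C
  have hint : ∀ a : ℝ, 0 ≤ a → MeasureTheory.IntegrableOn f (Set.Ioi a) := fun a ha =>
    (hexp a).mono' hc.aestronglyMeasurable
      ((MeasureTheory.ae_restrict_iff' measurableSet_Ioi).2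
        (Eventually.of_forall fun x hx => h x (ha.trans (le_of_lt hx))))
  refine ⟨∫ τ in Set.Ioi 0, f τ, C / δ, δ, hδ, fun t ht => ?_⟩
  have hsplit := intervalIntegral.integral_interval_add_Ioi (hint 0 le_rfl) (hint t ht)
  beta_reduce
  rw [← hsplit, sub_add_cancel_left, norm_neg]
  calc ‖∫ x in Set.Ioi t, f x‖ ≤ ∫ x in Set.Ioi t, C * Real.exp (-δ * x) :=
        MeasureTheory.norm_integral_le_of_norm_le (hexp t)
          ((MeasureTheory.ae_restrict_iff' measurableSet_Ioi).2
            (Eventually.of_forall fun x hx => h x (ht.trans (le_of_lt hx))))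
    _ = C / δ * Real.exp (-δ * t) := by
        rw [MeasureTheory.integral_const_mul, integral_exp_mul_Ioi (neg_lt_zero.2 hδ)]
        field_simp

theorem tendsto_zero (hf : ExpDecay f) : Tendsto f atTop (𝓝 0) := by
  obtain ⟨C, δ, hδ, h⟩ := hf
  refine squeeze_zero_norm' (a := fun t => C * Real.exp (-δ * t))
    ((eventually_ge_atTop 0).mono h) ?_
  have : Tendsto (fun t : ℝ => Real.exp (-δ * t)) atTop (𝓝 0) :=
    Real.tendsto_exp_atBot.comp (tendsto_id.const_mul_atTop_of_neg (neg_lt_zero.2 hδ))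
  simpa using this.const_mul C

end ExpDecay

/-! ### Convolution and normalised monomials. -/

section halfConv

variable {f g : ℝ → ℂ}

theorem halfConv_comm (f g : ℝ → ℂ) : halfConv f g = halfConv g f := by
  funext t
  have := intervalIntegral.integral_comp_sub_left (a := 0) (b := t)
    (fun τ => f (t - τ) * g τ) t
  simp only [sub_sub_cancel, sub_self, sub_zero] at this
  rw [halfConv, ← this, halfConv]
  simp_rw [mul_comm]

theorem halfConv_add_left {f₁ f₂ : ℝ → ℂ} (h₁ : Continuous f₁) (h₂ : Continuous f₂)
    (hg : Continuous g) (t : ℝ) :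
    halfConv (fun s => f₁ s + f₂ s) g t = halfConv f₁ g t + halfConv f₂ g t := by
  simp only [halfConv]
  rw [← intervalIntegral.integral_add]
  · simp_rw [add_mul]
  · exact Continuous.intervalIntegrable (by fun_prop) _ _
  · exact Continuous.intervalIntegrable (by fun_prop) _ _

theorem halfConv_sum_left {ι : Type*} (s : Finset ι) (a : ι → ℂ) (F : ι → ℝ → ℂ)
    (hF : ∀ i, Continuous (F i)) (hg : Continuous g) (t : ℝ) :
    halfConv (fun s' => ∑ i ∈ s, a i * F i s') g t = ∑ i ∈ s, a i * halfConv (F i) g t := by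
  simp only [halfConv, Finset.sum_mul]
  rw [intervalIntegral.integral_finsetSum]
  · simp_rw [mul_assoc, intervalIntegral.integral_const_mul]
  · intro i _
    have := hF i
    exact Continuous.intervalIntegrable (by fun_prop) _ _

/-- The normalised monomial `tⁿ / n!`. -/
noncomputable def divPow (n : ℕ) (t : ℝ) : ℂ := (t : ℂ) ^ n / (n.factorial : ℂ)

@[fun_prop]
theorem continuous_divPow (n : ℕ) : Continuous (divPow n) := by
  unfold divPow
  fun_prop

theorem hasDerivAt_divPow_succ (n : ℕ) (t : ℝ) :
    HasDerivAt (divPow (n + 1)) (divPow n t) t := by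
  have h := ((Complex.ofRealCLM.hasDerivAt (x := t)).pow (n + 1)).div_const
    (((n + 1).factorial : ℕ) : ℂ)
  convert! h using 1
  have : ((n.factorial : ℕ) : ℂ) ≠ 0 := by exact_mod_cast n.factorial_ne_zero
  have h2 : ((n : ℂ) + 1) ≠ 0 := by exact_mod_cast n.succ_ne_zero
  simp only [divPow, Nat.factorial_succ]
  push_cast
  simp
  field_simp

theorem divPow_zero : divPow 0 = fun _ => 1 := by
  funext t
  simp [divPow]

theorem divPow_succ_zero (n : ℕ) : divPow (n + 1) 0 = 0 := by simp [divPow]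

/-- Integration by parts moves one degree from the left factor to the right one; the boundary terms
vanish because `divPow (n + 1) 0 = 0`. -/
theorem halfConv_divPow (n m : ℕ) : halfConv (divPow n) (divPow m) = divPow (n + m + 1) := by
  induction n generalizing m with
  | zero =>
    funext t
    have := intervalIntegral.integral_eq_sub_of_hasDerivAt (a := 0) (b := t)
      (fun x _ => hasDerivAt_divPow_succ m x)
      (Continuous.intervalIntegrable (by fun_prop) _ _)
    simp only [halfConv, divPow_zero, one_mul, this, divPow_succ_zero, sub_zero, zero_add]
  | succ n ih =>
    funext t
    have hd : ∀ x : ℝ, HasDerivAt (fun τ => divPow (n + 1) (t - τ) * divPow (m + 1) τ)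
        (divPow (n + 1) (t - x) * divPow m x - divPow n (t - x) * divPow (m + 1) x) x := by
      intro x
      have h1 : HasDerivAt (fun τ => divPow (n + 1) (t - τ)) (-divPow n (t - x)) x := by
        simpa [Function.comp_def] using
          (hasDerivAt_divPow_succ n (t - x)).scomp x ((hasDerivAt_id x).const_sub t)
      convert! h1.mul (hasDerivAt_divPow_succ m x) using 1
      ring
    have := intervalIntegral.integral_eq_sub_of_hasDerivAt (a := 0) (b := t)
      (fun x _ => hd x) (Continuous.intervalIntegrable (by fun_prop) _ _)
    rw [intervalIntegral.integral_sub (Continuous.intervalIntegrable (by fun_prop) _ _)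
      (Continuous.intervalIntegrable (by fun_prop) _ _)] at this
    simp only [divPow_succ_zero, sub_self, zero_mul, mul_zero] at this
    have h2 := congrFun (ih (m + 1)) t
    simp only [halfConv] at h2 ⊢
    rw [sub_eq_zero.1 this, h2]
    congr 1
    ring

end halfConv

/-! ### Polynomials up to exponential decay. -/

/-- `f t` equals a polynomial of degree at most `n`, with coefficient `c / n!` of `tⁿ`, up to an
exponentially decaying function. -/
def PolyUpToDecay (n : ℕ) (c : ℂ) (f : ℝ → ℂ) : Prop :=
  ∃ a : ℕ → ℂ, a n = c ∧ ExpDecay (fun t => f t - ∑ i ∈ Finset.range (n + 1), a i * divPow i t)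

namespace PolyUpToDecay

variable {f g : ℝ → ℂ} {n m : ℕ} {c d : ℂ}

theorem of_expDecay (n : ℕ) (hf : ExpDecay f) : PolyUpToDecay n 0 f :=
  ⟨0, rfl, by simpa using hf⟩

theorem divPow (n : ℕ) : PolyUpToDecay n 1 (divPow n) := by
  refine ⟨Pi.single n 1, by simp, ?_⟩
  convert! ExpDecay.zero using 2 with t
  rw [Finset.sum_eq_single n] <;> simp +contextual

theorem add (hf : PolyUpToDecay n c f) (hg : PolyUpToDecay n d g) :
    PolyUpToDecay n (c + d) (fun t => f t + g t) := by
  obtain ⟨a, rfl, ha⟩ := hf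
  obtain ⟨b, rfl, hb⟩ := hg
  refine ⟨a + b, rfl, ?_⟩
  convert! ha.add hb using 2 with t
  simp only [Pi.add_apply, add_mul, Finset.sum_add_distrib]
  ring

theorem const_mul (k : ℂ) (hf : PolyUpToDecay n c f) :
    PolyUpToDecay n (k * c) (fun t => k * f t) := by
  obtain ⟨a, rfl, ha⟩ := hf
  refine ⟨fun i => k * a i, rfl, ?_⟩
  convert! ha.const_mul k using 2 with t
  simp only [mul_sub, Finset.mul_sum, mul_assoc]

theorem sum {ι : Type*} (s : Finset ι) {c : ι → ℂ} {F : ι → ℝ → ℂ}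
    (h : ∀ i ∈ s, PolyUpToDecay n (c i) (F i)) :
    PolyUpToDecay n (∑ i ∈ s, c i) (fun t => ∑ i ∈ s, F i t) := by
  classical
  induction s using Finset.induction_on with
  | empty => simpa using of_expDecay n ExpDecay.zero
  | insert i s hi ih =>
    simp only [Finset.sum_insert hi]
    exact (h i (by simp)).add (ih fun j hj => h j (by simp [hj]))

theorem mono (hf : PolyUpToDecay n c f) (h : n < m) : PolyUpToDecay m 0 f := by
  obtain ⟨a, rfl, ha⟩ := hf
  refine ⟨fun i => if i < n + 1 then a i else 0, by simp; omega, ?_⟩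
  convert! ha using 3 with t
  rw [← Finset.sum_subset (Finset.range_subset_range.2 (show n + 1 ≤ m + 1 by omega))]
  · exact Finset.sum_congr rfl fun i hi => by simp [Finset.mem_range.1 hi]
  · intro i _ hi
    rw [Finset.mem_range] at hi
    simp [hi]

/-- Brings terms of different degrees to a common one, so that a sum keeps only the coefficients of
the terms attaining it. -/
theorem mono_ite (hf : PolyUpToDecay n c f) (h : n ≤ m) :
    PolyUpToDecay m (if n = m then c else 0) f := by
  split_ifs with hnm
  · exact hnm ▸ hf
  · exact hf.mono (lt_of_le_of_ne h hnm)

theorem congr {c' : ℂ} (hf : PolyUpToDecay n c f) (hc : c = c') (h : ∀ t, f t = g t) :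
    PolyUpToDecay n c' g := by
  obtain rfl : f = g := funext h
  exact hc ▸ hf

/-- The binomial expansion of `(t - τ)ⁿ` leaves moments of `g` over `[0, t]`, each converging
exponentially fast. The coefficient can stay unspecified: in later use `n` lies strictly below the
degree that counts. -/
theorem halfConv_divPow_of_expDecay (n : ℕ) (hg : ExpDecay g) (hc : Continuous g) :
    ∃ c, PolyUpToDecay n c (halfConv (_root_.divPow n) g) := by
  have h1 : ∀ i : ℕ, ∃ L : ℂ, ExpDecay
      (fun t => (∫ τ in (0 : ℝ)..t, _root_.divPow i (-τ) * g τ) - L) := by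
    intro i
    refine ExpDecay.exists_integral_sub ?_ (by fun_prop)
    convert! (hg.pow_mul i).const_mul ((-1) ^ i / (i.factorial : ℂ)) using 2 with t
    simp only [_root_.divPow, Complex.ofReal_neg, neg_pow (t : ℂ)]
    ring
  choose L hL using h1
  refine ⟨_, congr (sum (Finset.range (n + 1)) (n := n)
    (F := fun i t => _root_.divPow i t * ∫ τ in (0 : ℝ)..t, _root_.divPow (n - i) (-τ) * g τ)
    (c := fun i => if i = n then L (n - i) * 1 else 0) fun i hi => ?_) rfl fun t => ?_⟩
  · refine mono_ite ?_ (by simpa [Nat.lt_succ_iff] using hi)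
    have h2 : PolyUpToDecay i 0 (fun t => _root_.divPow i t *
        ((∫ τ in (0 : ℝ)..t, _root_.divPow (n - i) (-τ) * g τ) - L (n - i))) := by
      apply of_expDecay
      convert! ((hL (n - i)).pow_mul i).const_mul (1 / (i.factorial : ℂ)) using 2 with t
      simp only [_root_.divPow]
      ring
    refine (((divPow i).const_mul (L (n - i))).add h2).congr (add_zero _) fun t => ?_
    ring
  · rw [halfConv]
    simp_rw [← intervalIntegral.integral_const_mul]
    rw [← intervalIntegral.integral_finsetSum
      (fun i _ => Continuous.intervalIntegrable (by fun_prop) _ _)]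
    congr 1
    funext τ
    simp_rw [← mul_assoc]
    rw [← Finset.sum_mul]
    congr 1
    simp only [_root_.divPow, sub_eq_add_neg, Complex.ofReal_add, Complex.ofReal_neg]
    rw [add_pow, Finset.sum_div]
    refine Finset.sum_congr rfl fun i hi => ?_
    have hi' : i ≤ n := by simpa [Nat.lt_succ_iff] using hi
    have hf := Nat.choose_mul_factorial_mul_factorial hi'
    have h1 : (i.factorial : ℂ) ≠ 0 := by exact_mod_cast i.factorial_ne_zero
    have h2 : ((n - i).factorial : ℂ) ≠ 0 := by exact_mod_cast (n - i).factorial_ne_zero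
    have h3 : (n.factorial : ℂ) ≠ 0 := by exact_mod_cast n.factorial_ne_zero
    rw [← hf] at h3 ⊢
    push_cast at h3 ⊢
    have h4 := left_ne_zero_of_mul (left_ne_zero_of_mul h3)
    field_simp

/-- Only the product of the two leading monomials reaches degree `n + m + 1`. Terms with one
decaying factor have degree at most `max n m`, and the convolution of both errors decays. -/
theorem halfConv (hf : PolyUpToDecay n c f) (hg : PolyUpToDecay m d g)
    (cf : Continuous f) (cg : Continuous g) :
    PolyUpToDecay (n + m + 1) (c * d) (halfConv f g) := by
  obtain ⟨a, rfl, ha⟩ := hf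
  obtain ⟨b, rfl, hb⟩ := hg
  set h : ℝ → ℂ := fun t => f t - ∑ i ∈ Finset.range (n + 1), a i * _root_.divPow i t with hh
  set k : ℝ → ℂ := fun t => g t - ∑ i ∈ Finset.range (m + 1), b i * _root_.divPow i t with hk
  have ch : Continuous h := by fun_prop
  have ck : Continuous k := by fun_prop
  have ef : f = fun t => ∑ i ∈ Finset.range (n + 1), a i * _root_.divPow i t + h t := by
    funext t; simp [hh]
  have eg : g = fun t => ∑ i ∈ Finset.range (m + 1), b i * _root_.divPow i t + k t := by
    funext t; simp [hk]
  have key : ∀ u : ℝ → ℂ, Continuous u → ∀ t, _root_.halfConv u g t =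
      ∑ j ∈ Finset.range (m + 1), b j * _root_.halfConv (_root_.divPow j) u t
        + _root_.halfConv u k t := by
    intro u cu t
    rw [halfConv_comm, eg, halfConv_add_left (by fun_prop) ck cu,
      halfConv_sum_left _ _ _ (by fun_prop) cu, halfConv_comm k]
  have hdecay : ∀ N M (u : ℝ → ℂ), ExpDecay u → Continuous u → N < M →
      PolyUpToDecay M 0 (_root_.halfConv (_root_.divPow N) u) := by
    intro N M u hu cu hNM
    obtain ⟨e, he⟩ := halfConv_divPow_of_expDecay N hu cu
    exact he.mono hNM
  have h1 : PolyUpToDecay (n + m + 1) 0 (_root_.halfConv h g) := by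
    refine ((sum (Finset.range (m + 1)) (n := n + m + 1)
      (F := fun j t => b j * _root_.halfConv (_root_.divPow j) h t) (c := fun j => b j * 0)
      fun j hj => ?_).add (of_expDecay _ (ha.halfConv hb))).congr (by simp)
      fun t => (key h ch t).symm
    exact (hdecay j _ h ha ch (by have := Finset.mem_range.1 hj; omega)).const_mul _
  have h2 : ∀ i ∈ Finset.range (n + 1), PolyUpToDecay (n + m + 1) (if i = n then b m else 0)
      (_root_.halfConv (_root_.divPow i) g) := by
    intro i hi
    have hi := Finset.mem_range.1 hi
    refine ((sum (Finset.range (m + 1)) (n := n + m + 1)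
      (F := fun j t => b j * _root_.divPow (j + i + 1) t)
      (c := fun j => b j * if j + i + 1 = n + m + 1 then 1 else 0)
      fun j hj => ?_).add (hdecay i _ k hb ck (by omega))).congr ?_ fun t => ?_
    · have hj := Finset.mem_range.1 hj
      exact ((divPow _).mono_ite (by omega)).const_mul _
    · rw [add_zero]
      split_ifs with hin
      · rw [Finset.sum_eq_single m]
        · simp [hin, add_comm]
        · intro j _ hj
          rw [if_neg (by omega), mul_zero]
        · simp
      · refine Finset.sum_eq_zero fun j hj => ?_
        have hj := Finset.mem_range.1 hj
        rw [if_neg (by omega), mul_zero]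
    · rw [key _ (by fun_prop) t]
      simp_rw [halfConv_divPow]
  refine ((sum (Finset.range (n + 1)) fun i hi => (h2 i hi).const_mul (a i)).add h1).congr ?_
    fun t => ?_
  · rw [Finset.sum_eq_single n] <;> simp +contextual
  · conv_rhs => rw [ef]
    rw [halfConv_add_left (by fun_prop) ch cg, halfConv_sum_left _ _ _ (by fun_prop) cg]

end PolyUpToDecay

/-! ### Triangular chains of linear differential equations. -/

theorem ExpDecay.cexp {μ : ℂ} (hμ : μ.re < 0) : ExpDecay (fun t => Complex.exp (μ * t)) :=
  ⟨1, -μ.re, neg_pos.2 hμ, fun t _ => by simp [Complex.norm_exp]⟩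

/-- Variation of constants: integrate the derivative of `exp(μ (t - τ)) u(τ)` over `[0, t]`. -/
theorem eq_exp_add_halfConv {u g : ℝ → ℂ} {μ s : ℂ} (hg : Continuous g)
    (hu : ∀ t, HasDerivAt u (μ * u t + s * g t) t) (t : ℝ) :
    u t = u 0 * Complex.exp (μ * t) + s * halfConv (fun r => Complex.exp (μ * r)) g t := by
  have hd : ∀ x : ℝ, HasDerivAt (fun τ : ℝ => Complex.exp (μ * (t - τ : ℝ)) * u τ)
      (s * (Complex.exp (μ * (t - x : ℝ)) * g x)) x := by
    intro x
    have h1 : HasDerivAt (fun τ : ℝ => μ * ((t - τ : ℝ) : ℂ)) (-μ) x := by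
      have := ((Complex.ofRealCLM.hasDerivAt (x := x)).const_sub (t : ℂ)).const_mul μ
      simpa using this
    convert! h1.cexp.mul (hu x) using 1
    ring
  have := intervalIntegral.integral_eq_sub_of_hasDerivAt (a := 0) (b := t)
    (fun x _ => hd x) (Continuous.intervalIntegrable (by fun_prop) _ _)
  rw [intervalIntegral.integral_const_mul] at this
  simp only [halfConv]
  rw [this]
  simp
  ring

/-- Solutions of the chain `v n' = μ n * v n + σ n * v (n + 1)` whose first `ℓ` equations form a
nilpotent Jordan block and whose remaining equations are stable. -/
theorem PolyUpToDecay.of_chain {N ℓ : ℕ} (hℓ : 0 < ℓ) {μ σ : ℕ → ℂ} {v : ℕ → ℝ → ℂ}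
    (hv : ∀ n t, HasDerivAt (v n) (μ n * v n t + σ n * v (n + 1) t) t)
    (hN : ∀ n, N ≤ n → v n = 0) (hμ : ∀ n, n < ℓ → μ n = 0)
    (hμ' : ∀ n, ℓ ≤ n → n < N → (μ n).re < 0) (hσ : ∀ n, n + 1 < ℓ → σ n = 1)
    (hσ' : σ (ℓ - 1) = 0) (n : ℕ) :
    PolyUpToDecay (ℓ - 1) (if n = 0 then v (ℓ - 1) 0 else 0) (v n) := by
  have hc : ∀ n, Continuous (v n) := fun n =>
    continuous_iff_continuousAt.2 fun t => (hv n t).continuousAt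
  -- Downward induction from the end of the chain: a stable equation driven by a decaying input has
  -- a decaying solution.
  have hdecay : ∀ n, ℓ ≤ n → ExpDecay (v n) := by
    intro n hn
    by_cases hnN : N ≤ n
    · rw [hN n hnN]
      exact ExpDecay.zero
    · push Not at hnN
      have hle := hnN.le
      induction hle using Nat.decreasingInduction with
      | self => omega
      | of_succ k hk ih =>
        have hnext : ExpDecay (v (k + 1)) := by
          by_cases hk' : k + 1 < N
          · exact ih (by omega) hk'
          · rw [hN _ (by omega)]
            exact ExpDecay.zero
        have he := ExpDecay.cexp (hμ' k hn hk)
        convert! (he.const_mul (v k 0)).add ((he.halfConv hnext).const_mul (σ k)) using 1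
        funext t
        exact eq_exp_add_halfConv (hc _) (hv k) t
  -- Climbing from the last row of the block, which is constant because `σ (ℓ - 1) = 0`; each row
  -- above integrates the one below and gains one degree.
  have hpoly : ∀ d, d + 1 ≤ ℓ → PolyUpToDecay d (v (ℓ - 1) 0) (v (ℓ - 1 - d)) := by
    intro d hd
    induction d with
    | zero =>
      refine ((PolyUpToDecay.divPow 0).const_mul (v (ℓ - 1) 0)).congr (mul_one _) fun t => ?_
      have := eq_exp_add_halfConv (hc _) (hv (ℓ - 1)) t
      rw [hμ _ (by omega), hσ'] at this
      simpa [_root_.divPow] using this.symm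
    | succ d ih =>
      have h1 := ((PolyUpToDecay.divPow 0).halfConv (ih (by omega)) (by fun_prop) (hc _))
      rw [zero_add, one_mul] at h1
      refine (((PolyUpToDecay.divPow 0).mono (Nat.succ_pos d)).const_mul
        (v (ℓ - 1 - (d + 1)) 0) |>.add h1).congr (by simp) fun t => ?_
      have := eq_exp_add_halfConv (hc _) (hv (ℓ - 1 - (d + 1))) t
      rw [hμ _ (by omega), hσ _ (by omega), show ℓ - 1 - (d + 1) + 1 = ℓ - 1 - d by omega] at this
      rw [this]
      simp [divPow_zero]
  by_cases hn : ℓ ≤ n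
  · rw [if_neg (by omega)]
    exact PolyUpToDecay.of_expDecay _ (hdecay n hn)
  · have := (hpoly (ℓ - 1 - n) (by omega)).mono_ite (m := ℓ - 1) (by omega)
    rw [show ℓ - 1 - (ℓ - 1 - n) = n by omega] at this
    refine this.congr ?_ fun _ => rfl
    exact if_congr (by omega) rfl rfl

/-! ### Matrix exponentials and Duhamel's formula. -/

section MatrixExp

open NormedSpace Matrix

variable {N : ℕ} {𝕂 : Type*} [RCLike 𝕂]

open scoped Matrix.Norms.Operator in
theorem continuous_matrix_exp : Continuous (exp : Matrix (Fin N) (Fin N) 𝕂 → _) :=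
  exp_continuous

open scoped Matrix.Norms.Operator in
theorem hasDerivAt_matrix_exp_smul (A : Matrix (Fin N) (Fin N) 𝕂) (t : ℝ) :
    HasDerivAt (fun s : ℝ => exp (s • A)) (exp (t • A) * A) t :=
  hasDerivAt_exp_smul_const A t

open scoped Matrix.Norms.Operator in
theorem hasDerivAt_matrix_exp_smul' (A : Matrix (Fin N) (Fin N) 𝕂) (t : ℝ) :
    HasDerivAt (fun s : ℝ => exp (s • A)) (A * exp (t • A)) t :=
  hasDerivAt_exp_smul_const' A t

open scoped Matrix.Norms.Operator in
theorem hasDerivAt_exp_smul_mulVec (A : Matrix (Fin N) (Fin N) 𝕂) (w : Fin N → 𝕂) (i : Fin N)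
    (t : ℝ) : HasDerivAt (fun s : ℝ => (exp (s • A) *ᵥ w) i) ((A *ᵥ (exp (t • A) *ᵥ w)) i) t := by
  let L : Matrix (Fin N) (Fin N) 𝕂 →L[ℝ] 𝕂 := LinearMap.toContinuousLinearMap
    { toFun := fun B => (B *ᵥ w) i
      map_add' := fun B C => by simp [add_mulVec]
      map_smul' := fun r B => by simp [smul_mulVec] }
  have := L.hasFDerivAt.comp_hasDerivAt t (hasDerivAt_exp_smul_const' (𝕂 := ℝ) A t)
  rw [mulVec_mulVec]
  exact this

open scoped Matrix.Norms.Operator in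
-- Duhamel's formula: `exp((t - τ) A) exp(τ B)` interpolates between the two exponentials, and its
-- `τ`-derivative contains only `B - A`.
theorem dotProduct_exp_sub_exp (A B : Matrix (Fin N) (Fin N) ℝ) (c β : Fin N → ℝ) (t : ℝ) :
    c ⬝ᵥ (exp (t • B) *ᵥ β) - c ⬝ᵥ (exp (t • A) *ᵥ β) =
      ∫ τ in (0 : ℝ)..t, c ⬝ᵥ ((exp ((t - τ) • A) * (B - A) * exp (τ • B)) *ᵥ β) := by
  let L : Matrix (Fin N) (Fin N) ℝ →L[ℝ] ℝ := LinearMap.toContinuousLinearMap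
    { toFun := fun B => c ⬝ᵥ (B *ᵥ β)
      map_add' := fun B C => by simp [add_mulVec]
      map_smul' := fun r B => by simp [smul_mulVec] }
  have hd : ∀ x : ℝ, HasDerivAt (fun τ : ℝ => L (exp ((t - τ) • A) * exp (τ • B)))
      (L (exp ((t - x) • A) * (B - A) * exp (x • B))) x := by
    intro x
    have h1 : HasDerivAt (fun τ : ℝ => exp ((t - τ) • A)) (-(exp ((t - x) • A) * A)) x := by
      have := (hasDerivAt_matrix_exp_smul A (t - x)).scomp x ((hasDerivAt_id x).const_sub t)
      simp only [Function.comp_def, neg_smul, one_smul] at this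
      exact this
    have h2 := L.hasFDerivAt.comp_hasDerivAt x (h1.mul (hasDerivAt_matrix_exp_smul' B x))
    convert! h2 using 2
    noncomm_ring
  have hce := continuous_matrix_exp (N := N) (𝕂 := ℝ)
  have := intervalIntegral.integral_eq_sub_of_hasDerivAt (a := 0) (b := t)
    (fun x _ => hd x) (Continuous.intervalIntegrable (by fun_prop) _ _)
  simp only [L, LinearMap.coe_toContinuousLinearMap', LinearMap.coe_mk, AddHom.coe_mk] at this
  rw [this]
  simp

open scoped Matrix.Norms.Operator in
-- By Duhamel's formula the difference quotient equals `G ξ` exactly for `ξ ≠ ξ₀`, so continuity of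
-- `G` suffices.
theorem hasDerivAt_dotProduct_exp (A : ℝ → Matrix (Fin N) (Fin N) ℝ) (S : Matrix (Fin N) (Fin N) ℝ)
    (hA : Continuous A) (ξ₀ : ℝ) (hS : ∀ ξ, A ξ - A ξ₀ = (ξ - ξ₀) • S) (c β : Fin N → ℝ) (t : ℝ) :
    HasDerivAt (fun ξ => c ⬝ᵥ (exp (t • A ξ) *ᵥ β))
      (∫ τ in (0 : ℝ)..t, c ⬝ᵥ ((exp ((t - τ) • A ξ₀) * S * exp (τ • A ξ₀)) *ᵥ β)) ξ₀ := by
  set G : ℝ → ℝ := fun ξ =>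
    ∫ τ in (0 : ℝ)..t, c ⬝ᵥ ((exp ((t - τ) • A ξ₀) * S * exp (τ • A ξ)) *ᵥ β) with hG
  have hce := continuous_matrix_exp (N := N) (𝕂 := ℝ)
  have hcont : Continuous G := by
    apply intervalIntegral.continuous_parametric_intervalIntegral_of_continuous'
    simp only [Function.uncurry_def]
    fun_prop
  rw [hasDerivAt_iff_tendsto_slope]
  refine ((hcont.tendsto ξ₀).mono_left nhdsWithin_le_nhds).congr' ?_
  filter_upwards [self_mem_nhdsWithin] with ξ hξ
  have hne : ξ - ξ₀ ≠ 0 := sub_ne_zero.2 hξ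
  rw [slope_def_field, dotProduct_exp_sub_exp, eq_div_iff hne, hG, hS]
  simp [smul_mulVec, mul_comm]

end MatrixExp

/-! ### The dominant Jordan block. -/

section Jordan

open Matrix Polynomial

variable {N : ℕ} {A M J : Matrix (Fin N) (Fin N) ℂ} {lam : ℂ} {ℓ : ℕ}

theorem charpoly_conj_eq_prod (hM : IsUnit M.det) (hJ : IsJordanMatrix J)
    (hA : A = M * J * M⁻¹) : A.charpoly = ∏ i, (X - C (J i i)) := by
  have hup : J.IsUpperTriangular := by
    intro i j hij
    have hij : (j : ℕ) < (i : ℕ) := hij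
    exact (hJ i j).1 (by rintro rfl; omega) (by omega)
  rw [← charpoly_of_isUpperTriangular J hup, hA]
  obtain ⟨U, rfl⟩ := (isUnit_iff_isUnit_det M).2 hM
  simpa only [coe_units_inv] using charpoly_units_conj U J

theorem diag_mem_spectrum (hM : IsUnit M.det) (hJ : IsJordanMatrix J)
    (hA : A = M * J * M⁻¹) (i : Fin N) : J i i ∈ spectrum ℂ A := by
  rw [mem_spectrum_iff_isRoot_charpoly, charpoly_conj_eq_prod hM hJ hA, IsRoot.def, eval_prod]
  exact Finset.prod_eq_zero (Finset.mem_univ i) (by simp)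

/-- One more diagonal entry `lam` beyond the first `ℓ` would make the root multiplicity at least `ℓ
+ 1`. -/
theorem diag_ne_of_rootMultiplicity (hM : IsUnit M.det) (hJ : IsJordanMatrix J)
    (hA : A = M * J * M⁻¹) (hℓN : ℓ ≤ N) (halg : A.charpoly.rootMultiplicity lam = ℓ)
    (hfirst : ∀ i : Fin N, (i : ℕ) < ℓ → J i i = lam) (i : Fin N) (hi : ℓ ≤ i) :
    J i i ≠ lam := by
  intro h
  have hroots : (∏ i, (X - C (J i i))).roots = Finset.univ.val.map (fun i => J i i) := by
    have := roots_multiset_prod_X_sub_C (Finset.univ.val.map fun i => J i i)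
    rwa [Multiset.map_map] at this
  rw [charpoly_conj_eq_prod hM hJ hA, ← count_roots, hroots, Multiset.count_map] at halg
  have hcard : (Finset.univ.filter fun j : Fin N => lam = J j j).card = ℓ := halg
  have hsub : (insert i (Finset.univ.filter fun j : Fin N => (j : ℕ) < ℓ)) ⊆
      Finset.univ.filter fun j : Fin N => lam = J j j := by
    intro j hj
    rw [Finset.mem_insert] at hj
    simp only [Finset.mem_filter, Finset.mem_univ, true_and] at hj ⊢
    rcases hj with rfl | hj
    · exact h.symm
    · exact (hfirst j hj).symm
  have := Finset.card_le_card hsub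
  rw [Finset.card_insert_of_notMem (by simp [hi]), Fin.card_filter_val_lt, hcard] at this
  omega

/-- A zero on the superdiagonal would start a new block at `j`, making column `j` of `M` an
eigenvector independent of the first column, against geometric multiplicity one. -/
theorem superdiag_eq_one (hM : IsUnit M.det) (hJ : IsJordanMatrix J)
    (hA : A = M * J * M⁻¹)
    (hgeom : Module.finrank ℂ (Module.End.eigenspace (Matrix.toLin' A) lam) = 1)
    (hfirst : ∀ i : Fin N, (i : ℕ) < ℓ → J i i = lam) (i j : Fin N)
    (hij : (i : ℕ) + 1 = j) (hj : (j : ℕ) < ℓ) : J i j = 1 := by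
  refine (((hJ i j).2 hij).resolve_left fun h0 => ?_).1
  let o : Fin N := ⟨0, by omega⟩
  have hMu := (isUnit_iff_isUnit_det M).2 hM
  have heig : ∀ k : Fin N, (∀ r, r ≠ k → J r k = 0) → J k k = lam →
      M *ᵥ Pi.single k 1 ∈ Module.End.eigenspace (Matrix.toLin' A) lam := by
    intro k hk hkk
    rw [Module.End.mem_eigenspace_iff, toLin'_apply, hA, mulVec_mulVec, Matrix.mul_assoc,
      nonsing_inv_mul _ hM, Matrix.mul_one, ← mulVec_mulVec, ← mulVec_smul]
    congr 1
    ext r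
    by_cases hr : r = k
    · subst hr; simp [hkk]
    · simp [hk r hr, hr]
  have h1 := heig o (fun r hr => (hJ r o).1 hr (by simp [o])) (hfirst o (by simp [o]; omega))
  have h2 := heig j (fun r hr => by
    by_cases hrj : (r : ℕ) + 1 = j
    · obtain rfl : r = i := Fin.ext (by omega)
      exact h0
    · exact (hJ r j).1 hr hrj) (hfirst j hj)
  have hoj : o ≠ j := fun h => by
    have := congrArg Fin.val h
    simp [o] at this
    omega
  have hinj := mulVec_injective_of_isUnit hMu
  have hne : (⟨_, h1⟩ : Module.End.eigenspace (Matrix.toLin' A) lam) ≠ 0 := by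
    intro h
    have h3 : M *ᵥ Pi.single o 1 = M *ᵥ 0 := by simpa using congrArg Subtype.val h
    have := congrFun (hinj h3) o
    simp at this
  obtain ⟨c, hc⟩ := (finrank_eq_one_iff_of_nonzero' _ hne).1 hgeom ⟨_, h2⟩
  have h3 : M *ᵥ (c • Pi.single o 1) = M *ᵥ Pi.single j 1 := by
    rw [mulVec_smul]
    exact congrArg Subtype.val hc
  have := congrFun (hinj h3) j
  simp [hoj.symm] at this

/-- The matrix exponential of a Jordan matrix with dominant first block, applied to a vector. -/
theorem polyUpToDecay_exp_mulVec (hJ : IsJordanMatrix J) (hℓ : 0 < ℓ) (hℓN : ℓ ≤ N)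
    (hfirst : ∀ i : Fin N, (i : ℕ) < ℓ → J i i = lam)
    (hrest : ∀ i : Fin N, ℓ ≤ (i : ℕ) → (J i i).re < lam.re)
    (hsup : ∀ i j : Fin N, (i : ℕ) + 1 = j → (j : ℕ) < ℓ → J i j = 1)
    (w : Fin N → ℂ) (i : Fin N) :
    PolyUpToDecay (ℓ - 1) (if (i : ℕ) = 0 then w ⟨ℓ - 1, by omega⟩ else 0)
      (fun t => Complex.exp (-lam * t) * (NormedSpace.exp (t • J) *ᵥ w) i) := by
  -- Extension by zero beyond `N` makes the last row obey the same recursion as the others.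
  let v : ℕ → ℝ → ℂ := fun n => if h : n < N then
    fun t => Complex.exp (-lam * t) * (NormedSpace.exp (t • J) *ᵥ w) ⟨n, h⟩ else 0
  let μ : ℕ → ℂ := fun n => if h : n < N then J ⟨n, h⟩ ⟨n, h⟩ - lam else 0
  let σ : ℕ → ℂ := fun n => if h : n + 1 < N then J ⟨n, by omega⟩ ⟨n + 1, h⟩ else 0
  have key := PolyUpToDecay.of_chain (N := N) (v := v) (μ := μ) (σ := σ) hℓ ?_ ?_ ?_ ?_ ?_ ?_ i
  · have hl : ℓ - 1 < N := by omega
    simpa [v, hl] using key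
  · intro n t
    by_cases hn : n < N
    · have h1 : HasDerivAt (fun t : ℝ => -lam * (t : ℂ)) (-lam) t := by
        simpa using (Complex.ofRealCLM.hasDerivAt (x := t)).const_mul (-lam)
      have h2 := h1.cexp.mul (hasDerivAt_exp_smul_mulVec J w ⟨n, hn⟩ t)
      simp only [v, hn, dif_pos]
      convert! h2 using 1
      have h3 : (J *ᵥ (NormedSpace.exp (t • J) *ᵥ w)) ⟨n, hn⟩ =
          J ⟨n, hn⟩ ⟨n, hn⟩ * (NormedSpace.exp (t • J) *ᵥ w) ⟨n, hn⟩ +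
          if h : n + 1 < N then J ⟨n, hn⟩ ⟨n + 1, h⟩ *
            (NormedSpace.exp (t • J) *ᵥ w) ⟨n + 1, h⟩ else 0 := by
        conv_lhs => rw [mulVec, dotProduct]
        split_ifs with h
        · rw [Finset.sum_eq_add_of_mem ⟨n, hn⟩ ⟨n + 1, h⟩ (Finset.mem_univ _)
            (Finset.mem_univ _) (by simp)]
          rintro c - ⟨hc1, hc2⟩
          rw [(hJ _ c).1 hc1.symm (fun hc => hc2 (Fin.ext hc.symm)), zero_mul]
        · rw [Finset.sum_eq_single ⟨n, hn⟩ _ (by simp), add_zero]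
          intro c _ hc1
          rw [(hJ _ c).1 hc1.symm (by simp only []; omega), zero_mul]
      rw [h3]
      simp only [μ, σ, hn, dif_pos]
      split_ifs with h
      · ring
      · simp only [Pi.zero_apply]; ring
    · have hn' : ¬ n + 1 < N := by omega
      simp [v, μ, σ, hn, hn']
  · intro n hn
    simp [v, not_lt.2 hn]
  · intro n hn
    simp [μ, show n < N by omega, hfirst ⟨n, by omega⟩ hn]
  · intro n hn hnN
    simpa [μ, hnN] using hrest ⟨n, hnN⟩ hn
  · intro n hn
    simpa [σ, show n + 1 < N by omega] using hsup ⟨n, by omega⟩ ⟨n + 1, by omega⟩ rfl hn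
  · simp only [σ]
    split_ifs with h
    -- A one just after the block would equate two diagonal entries, contradicting dominance.
    · refine ((hJ ⟨ℓ - 1, by omega⟩ ⟨ℓ - 1 + 1, h⟩).2 rfl).resolve_right fun h1 => ?_
      have h2 := hrest ⟨ℓ - 1 + 1, h⟩ (by simp only []; omega)
      rw [← h1.2, hfirst ⟨ℓ - 1, by omega⟩ (by simp only []; omega)] at h2
      exact lt_irrefl _ h2
    · rfl

end Jordan

/-! ### Asymptotics of quotients. -/

section Quotient

open Polynomial

theorem PolyUpToDecay.exists_polynomial {n : ℕ} {c : ℂ} {f : ℝ → ℂ} (hf : PolyUpToDecay n c f) :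
    ∃ p : ℂ[X], p.natDegree ≤ n ∧ p.coeff n = c / (n.factorial : ℂ) ∧
      ExpDecay (fun t => f t - p.eval (t : ℂ)) := by
  obtain ⟨a, rfl, ha⟩ := hf
  refine ⟨∑ i ∈ Finset.range (n + 1), monomial i (a i / (i.factorial : ℂ)), ?_, ?_, ?_⟩
  · refine natDegree_sum_le_of_forall_le _ _ fun i hi => (natDegree_monomial_le _).trans ?_
    exact Nat.lt_succ_iff.1 (Finset.mem_range.1 hi)
  · simp [finsetSum_coeff, coeff_monomial]
  · convert! ha using 3 with t
    rw [eval_finsetSum]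
    refine Finset.sum_congr rfl fun i _ => ?_
    simp only [eval_monomial, _root_.divPow]
    ring

theorem tendsto_eval_div_pow {p : ℂ[X]} {n : ℕ} (hp : p.natDegree ≤ n) :
    Tendsto (fun t : ℝ => p.eval (t : ℂ) / (t : ℂ) ^ n) atTop (𝓝 (p.coeff n)) := by
  have hinv : Tendsto (fun t : ℝ => ((t : ℂ))⁻¹) atTop (𝓝 0) := by
    have := (Complex.continuous_ofReal.tendsto 0).comp tendsto_inv_atTop_zero
    simpa [Function.comp_def] using this
  have hterm : ∀ i ∈ Finset.range (n + 1), Tendsto (fun t : ℝ => p.coeff i * ((t : ℂ)⁻¹) ^ (n - i))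
      atTop (𝓝 (p.coeff i * 0 ^ (n - i))) := fun i _ => (hinv.pow _).const_mul _
  have hsum := tendsto_finsetSum _ hterm
  rw [Finset.sum_eq_single n (by
    intro i hi hin
    have := Finset.mem_range.1 hi
    rw [zero_pow (by omega), mul_zero]) (by simp)] at hsum
  simp only [Nat.sub_self, pow_zero, mul_one] at hsum
  refine hsum.congr' ?_
  filter_upwards [eventually_gt_atTop 0] with t ht
  have ht' : (t : ℂ) ≠ 0 := by exact_mod_cast ht.ne'
  rw [eval_eq_sum_range' (Nat.lt_succ_iff.2 hp), Finset.sum_div]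
  refine Finset.sum_congr rfl fun i hi => ?_
  have hi' : i ≤ n := Nat.lt_succ_iff.1 (Finset.mem_range.1 hi)
  rw [inv_pow, ← div_eq_mul_inv, div_eq_div_iff (pow_ne_zero _ ht') (pow_ne_zero _ ht'),
    mul_assoc, ← pow_add, Nat.add_sub_cancel' hi']

theorem ExpDecay.tendsto_div_pow {f : ℝ → ℂ} (hf : ExpDecay f) (n : ℕ) :
    Tendsto (fun t : ℝ => f t / (t : ℂ) ^ n) atTop (𝓝 0) := by
  refine squeeze_zero_norm' ?_ (by simpa using hf.tendsto_zero.norm)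
  filter_upwards [eventually_ge_atTop 1] with t ht
  rw [norm_div, norm_pow, Complex.norm_real, Real.norm_of_nonneg (by linarith)]
  exact div_le_self (norm_nonneg _) (one_le_pow₀ ht)

theorem ExpDecay.eval_mul {f : ℝ → ℂ} (hf : ExpDecay f) (q : ℂ[X]) :
    ExpDecay (fun t => q.eval (t : ℂ) * f t) := by
  induction q using Polynomial.induction_on' with
  | add p q hp hq => simpa [add_mul] using hp.add hq
  | monomial n a => simpa [mul_assoc] using (hf.pow_mul n).const_mul a

/-- The quotient of two functions that are polynomial up to exponentially decaying terms is a
polynomial up to `O(t⁻¹)`. -/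
theorem PolyUpToDecay.exists_quotient {m n : ℕ} {κ ν : ℂ} {g d : ℝ → ℂ}
    (hd : PolyUpToDecay m κ d) (hg : PolyUpToDecay (m + n) ν g) (hκ : κ ≠ 0) :
    (∀ᶠ t in atTop, d t ≠ 0) ∧ ∃ q : ℂ[X], q.natDegree ≤ n ∧
      q.coeff n * (κ / (m.factorial : ℂ)) = ν / ((m + n).factorial : ℂ) ∧
      (fun t => g t / d t - q.eval (t : ℂ)) =O[atTop] (fun t : ℝ => t⁻¹) := by
  obtain ⟨p, hpn, hpc, hp⟩ := hd.exists_polynomial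
  obtain ⟨Q, hQn, hQc, hQ⟩ := hg.exists_polynomial
  have hpc0 : p.coeff m ≠ 0 := by
    rw [hpc]
    exact div_ne_zero hκ (by exact_mod_cast m.factorial_ne_zero)
  have hp0 : p ≠ 0 := fun h => hpc0 (by simp [h])
  have hpm : p.natDegree = m := le_antisymm hpn (le_natDegree_of_ne_zero hpc0)
  have hlim : Tendsto (fun t : ℝ => d t / (t : ℂ) ^ m) atTop (𝓝 (p.coeff m)) := by
    have := (tendsto_eval_div_pow hpn).add (hp.tendsto_div_pow m)
    rw [add_zero] at this
    refine this.congr fun t => ?_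
    ring
  have hdne : ∀ᶠ t in atTop, d t ≠ 0 := by
    filter_upwards [hlim.eventually_ne hpc0] with t ht h
    simp [h] at ht
  have hqn : (Q / p).natDegree ≤ n := by
    by_cases hq0 : Q / p = 0
    · simp [hq0]
    have h1 := natDegree_mul hp0 hq0
    rw [eq_sub_of_add_eq (EuclideanDomain.div_add_mod Q p)] at h1
    have h2 := natDegree_sub_le_of_le hQn
      ((natDegree_le_natDegree (degree_mod_lt Q hp0).le).trans
        (hpn.trans (Nat.le_add_right m n)))
    rw [max_self] at h2
    omega
  have hmod : (Q % p).coeff (m + n) = 0 := by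
    apply coeff_eq_zero_of_degree_lt
    refine (degree_mod_lt Q hp0).trans_le ?_
    rw [degree_eq_natDegree hp0, hpm]
    exact_mod_cast Nat.le_add_right m n
  have hdivmod := EuclideanDomain.div_add_mod Q p
  refine ⟨hdne, Q / p, hqn, ?_, ?_⟩
  -- The remainder has degree below `m`, so the top coefficient of the numerator comes from `p * (Q
  -- / p)` alone.
  · rw [← hQc, ← hpc]
    conv_rhs => rw [← hdivmod]
    rw [coeff_add, hmod, add_zero, coeff_mul_add_eq_of_natDegree_le hpn hqn, mul_comm]
  · set q := Q / p with hq
    set r := Q % p with hr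
    have hXr : (X * r).natDegree ≤ m := by
      by_cases hr0 : r = 0
      · simp [hr0]
      · rw [natDegree_X_mul hr0]
        have := natDegree_lt_natDegree hr0 (degree_mod_lt Q hp0)
        omega
    have hdec : ExpDecay (fun t => (t : ℂ) * ((g t - Q.eval (t : ℂ))
        - q.eval (t : ℂ) * (d t - p.eval (t : ℂ)))) := by
      apply ExpDecay.id_mul
      convert! hQ.add ((hp.eval_mul q).const_mul (-1)) using 2 with t
      ring
    -- `g / d - q` is `(r + (g - Q) - q (d - p)) / d`. Since `deg (X r) ≤ m`, its product with `t`
    -- has a finite limit, which gives `O(t⁻¹)`.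
    have hlim2 : Tendsto (fun t : ℝ => (t : ℂ) * (g t / d t - q.eval (t : ℂ))) atTop
        (𝓝 (((X * r).coeff m + 0) / p.coeff m)) := by
      refine (((tendsto_eval_div_pow hXr).add (hdec.tendsto_div_pow m)).div hlim hpc0).congr' ?_
      filter_upwards [hdne, eventually_gt_atTop 0] with t hdt ht
      have ht' : (t : ℂ) ≠ 0 := by exact_mod_cast ht.ne'
      have hev : Q.eval (t : ℂ) = p.eval (t : ℂ) * q.eval (t : ℂ) + r.eval (t : ℂ) := by
        rw [← eval_mul, ← eval_add, hdivmod]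
      simp only [eval_mul, eval_X, Pi.div_apply, hev]
      field_simp
      ring
    have hO := (isBigO_refl (fun t : ℝ => t⁻¹) atTop).smul (hlim2.isBigO_one ℝ)
    refine hO.congr' ?_ (Eventually.of_forall fun t => by simp)
    filter_upwards [eventually_gt_atTop 0] with t ht
    rw [Complex.real_smul, Complex.ofReal_inv, inv_mul_cancel_left₀ (by exact_mod_cast ht.ne')]

end Quotient

/-! ### Output and sensitivity in modal coordinates. -/

section Modal

open Matrix

variable {N : ℕ}

theorem continuous_ofRealMatrix :
    Continuous (Complex.ofRealHom.mapMatrix : Matrix (Fin N) (Fin N) ℝ →+* _) :=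
  continuous_id.matrix_map Complex.continuous_ofReal

open scoped Matrix.Norms.Operator in
theorem map_ofReal_exp_smul (A : Matrix (Fin N) (Fin N) ℝ) (t : ℝ) :
    (NormedSpace.exp (t • A)).map Complex.ofReal =
      NormedSpace.exp (t • A.map Complex.ofReal) := by
  have h := NormedSpace.map_exp (Complex.ofRealHom.mapMatrix : Matrix (Fin N) (Fin N) ℝ →+* _)
    continuous_ofRealMatrix (t • A)
  have h2 : (Complex.ofRealHom.mapMatrix : Matrix (Fin N) (Fin N) ℝ →+* _) (t • A) =
      t • A.map Complex.ofReal := by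
    ext i j
    simp
  rw [h2] at h
  exact h

theorem ofReal_dotProduct_mulVec (c β : Fin N → ℝ) (B : Matrix (Fin N) (Fin N) ℝ) :
    ((c ⬝ᵥ (B *ᵥ β) : ℝ) : ℂ) =
      (fun i => (c i : ℂ)) ⬝ᵥ (B.map Complex.ofReal *ᵥ fun i => (β i : ℂ)) := by
  simp [dotProduct, mulVec]

theorem exp_smul_conj {A M J : Matrix (Fin N) (Fin N) ℂ} (hM : IsUnit M.det)
    (hA : A = M * J * M⁻¹) (t : ℝ) :
    NormedSpace.exp (t • A) = M * NormedSpace.exp (t • J) * M⁻¹ := by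
  rw [← Matrix.exp_conj _ _ ((isUnit_iff_isUnit_det M).2 hM), hA]
  simp

namespace SISOSystem

variable (P : SISOSystem N) {M J : Matrix (Fin N) (Fin N) ℂ} (β : Fin N → ℝ)

theorem ofReal_output_eq (hM : IsUnit M.det) (hMJ : P.A₀C = M * J * M⁻¹) (t : ℝ) :
    ((P.c ⬝ᵥ (NormedSpace.exp (t • P.A₀) *ᵥ β) : ℝ) : ℂ) =
      P.z M ⬝ᵥ (NormedSpace.exp (t • J) *ᵥ modalVec M β) := by
  rw [ofReal_dotProduct_mulVec, map_ofReal_exp_smul, ← A₀C, exp_smul_conj hM hMJ, z, modalVec,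
    ← dotProduct_mulVec, mulVec_mulVec, mulVec_mulVec, Matrix.mul_assoc]

theorem ofReal_sensitivity_integrand_eq (hM : IsUnit M.det) (hMJ : P.A₀C = M * J * M⁻¹)
    (s t : ℝ) :
    ((P.c ⬝ᵥ ((NormedSpace.exp (s • P.A₀) * P.S * NormedSpace.exp (t • P.A₀)) *ᵥ β) : ℝ) : ℂ) =
      ∑ j, ∑ k, P.Sbar M j k * ((P.z M ᵥ* NormedSpace.exp (s • J)) j *
        (NormedSpace.exp (t • J) *ᵥ modalVec M β) k) := by
  have hmap : (NormedSpace.exp (s • P.A₀) * P.S * NormedSpace.exp (t • P.A₀)).map Complex.ofReal =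
      (NormedSpace.exp (s • P.A₀)).map Complex.ofReal * P.S.map Complex.ofReal *
        (NormedSpace.exp (t • P.A₀)).map Complex.ofReal := by
    have := fun B C : Matrix (Fin N) (Fin N) ℝ => map_mul Complex.ofRealHom.mapMatrix B C
    simp only [RingHom.mapMatrix_apply] at this
    erw [this, this]
    rfl
  have hrhs : ∑ j, ∑ k, P.Sbar M j k * ((P.z M ᵥ* NormedSpace.exp (s • J)) j *
        (NormedSpace.exp (t • J) *ᵥ modalVec M β) k) =
      (P.z M ᵥ* NormedSpace.exp (s • J)) ⬝ᵥ
        (P.Sbar M *ᵥ (NormedSpace.exp (t • J) *ᵥ modalVec M β)) := by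
    conv_rhs => rw [dotProduct]
    refine Finset.sum_congr rfl fun j _ => ?_
    conv_rhs => rw [mulVec, dotProduct, Finset.mul_sum]
    exact Finset.sum_congr rfl fun k _ => by ring
  rw [hrhs, ofReal_dotProduct_mulVec, hmap, map_ofReal_exp_smul, map_ofReal_exp_smul, ← A₀C,
    exp_smul_conj hM hMJ, exp_smul_conj hM hMJ, z, modalVec, Sbar]
  simp only [← dotProduct_mulVec, mulVec_mulVec, Matrix.mul_assoc]

theorem hasDerivAt_err (t : ℝ) :
    HasDerivAt (fun ξ => P.err β ξ t)
      (-P.k₀ β * ∫ τ in (0 : ℝ)..t, P.c ⬝ᵥ ((NormedSpace.exp ((t - τ) • P.A₀) * P.S *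
        NormedSpace.exp (τ • P.A₀)) *ᵥ β)) P.ξ₀ := by
  refine (hasDerivAt_dotProduct_exp P.A P.S ?_ P.ξ₀ (fun ξ => ?_) P.c β t).const_mul _
  · unfold A
    fun_prop
  · simp [A, sub_smul]

variable {lam : ℂ} {ℓ : ℕ}

/-- The output `c exp(A₀ t) β`, divided by `exp(lam t)`. -/
noncomputable def scaledOutput (lam : ℂ) (t : ℝ) : ℂ :=
  Complex.exp (-lam * t) * ((P.c ⬝ᵥ (NormedSpace.exp (t • P.A₀) *ᵥ β) : ℝ) : ℂ)

/-- The derivative of the output `c exp(A(ξ) t) β` at `ξ₀`, divided by `exp(lam t)`. -/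
noncomputable def scaledSensitivity (lam : ℂ) (t : ℝ) : ℂ :=
  Complex.exp (-lam * t) * ((∫ τ in (0 : ℝ)..t, P.c ⬝ᵥ ((NormedSpace.exp ((t - τ) • P.A₀) * P.S *
        NormedSpace.exp (τ • P.A₀)) *ᵥ β) : ℝ) : ℂ)

/-- No condition on `t` is needed: where the output vanishes, division by zero makes both sides
zero. -/
theorem logSens_eq (hcβ : P.c ⬝ᵥ β ≠ 0) (t : ℝ) :
    (P.logSens β t : ℂ) = P.ξ₀ * (P.scaledSensitivity β lam t / P.scaledOutput β lam t) := by
  have hk : (P.k₀ β : ℂ) ≠ 0 := by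
    rw [k₀]
    exact_mod_cast neg_ne_zero.2 (inv_ne_zero hcβ)
  rw [logSens, (P.hasDerivAt_err β t).deriv, err, scaledSensitivity, scaledOutput, ← A₀,
    mul_div_mul_left _ _ (Complex.exp_ne_zero _)]
  push_cast
  rw [mul_div_assoc', mul_assoc, mul_div_mul_left _ _ (neg_ne_zero.2 hk)]
  ring

theorem polyUpToDecay_scaled (hM : IsUnit M.det) (hMJ : P.A₀C = M * J * M⁻¹)
    (hℓ : 0 < ℓ) (hℓN : ℓ ≤ N)
    (hexp : ∀ (w : Fin N → ℂ) (i : Fin N),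
      PolyUpToDecay (ℓ - 1) (if (i : ℕ) = 0 then w ⟨ℓ - 1, by omega⟩ else 0)
        (fun t => Complex.exp (-lam * t) * (NormedSpace.exp (t • J) *ᵥ w) i)) :
    PolyUpToDecay (ℓ - 1) (P.z M ⟨0, by omega⟩ * modalVec M β ⟨ℓ - 1, by omega⟩)
      (P.scaledOutput β lam) ∧
    PolyUpToDecay (ℓ - 1 + ℓ) (P.z M ⟨0, by omega⟩ * modalVec M β ⟨ℓ - 1, by omega⟩ *
      P.Sbar M ⟨ℓ - 1, by omega⟩ ⟨0, by omega⟩) (P.scaledSensitivity β lam) := by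
  let o : Fin N := ⟨0, by omega⟩
  let l : Fin N := ⟨ℓ - 1, by omega⟩
  have ho : ∀ i : Fin N, (i : ℕ) = 0 ↔ i = o := fun i => by simp [o, Fin.ext_iff]
  simp only [ho] at hexp
  have hce : Continuous fun t : ℝ => NormedSpace.exp (t • J) :=
    continuous_matrix_exp.comp (by fun_prop)
  -- Entry `j` of the row `z exp(s J)` pairs `z` with `exp(s J)` applied to the basis vector `e_j`,
  -- whose entry at `ℓ - 1` is nonzero only for `j = l`.
  have hrow : ∀ j, PolyUpToDecay (ℓ - 1) (if j = l then P.z M o else 0)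
      (fun t => Complex.exp (-lam * t) * (P.z M ᵥ* NormedSpace.exp (t • J)) j) := by
    intro j
    refine (PolyUpToDecay.sum Finset.univ fun i _ =>
      (hexp (Pi.single j 1) i).const_mul (P.z M i)).congr ?_ fun t => ?_
    · simp [Pi.single_apply, l, eq_comm]
    · simp only [mulVec_single_one, vecMul, dotProduct, Finset.mul_sum, Matrix.col_apply]
      exact Finset.sum_congr rfl fun i _ => by ring
  constructor
  · refine (PolyUpToDecay.sum Finset.univ fun i _ =>
      (hexp (modalVec M β) i).const_mul (P.z M i)).congr ?_ fun t => ?_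
    · simp [o]
    · rw [scaledOutput, P.ofReal_output_eq β hM hMJ, dotProduct, Finset.mul_sum]
      exact Finset.sum_congr rfl fun i _ => by ring
  · have hidx : ℓ - 1 + (ℓ - 1) + 1 = ℓ - 1 + ℓ := by omega
    refine (PolyUpToDecay.sum Finset.univ fun j _ => PolyUpToDecay.sum Finset.univ fun k _ =>
      (hidx ▸ (hrow j).halfConv (hexp (modalVec M β) k) (by fun_prop) (by fun_prop)).const_mul
        (P.Sbar M j k)).congr ?_ fun t => ?_
    · rw [Finset.sum_eq_single l (by intro j _ hj; simp [hj]) (by simp),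
        Finset.sum_eq_single o (by intro j _ hj; simp [hj]) (by simp)]
      simp [o, l]
      ring
    · rw [scaledSensitivity, ← intervalIntegral.integral_ofReal]
      simp_rw [P.ofReal_sensitivity_integrand_eq β hM hMJ]
      have hF : ∀ j k, Continuous fun τ : ℝ => P.Sbar M j k *
          (Complex.exp (-lam * (t - τ : ℝ)) * (P.z M ᵥ* NormedSpace.exp ((t - τ) • J)) j *
            (Complex.exp (-lam * τ) * (NormedSpace.exp (τ • J) *ᵥ modalVec M β) k)) := by
        intro j k
        have := hce.comp (continuous_const.sub continuous_id : Continuous fun τ : ℝ => t - τ)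
        simp only [Function.comp_def] at this
        fun_prop
      simp only [halfConv]
      simp_rw [← intervalIntegral.integral_const_mul]
      calc _ = ∑ j, ∫ τ in (0 : ℝ)..t, ∑ k, P.Sbar M j k *
          (Complex.exp (-lam * (t - τ : ℝ)) * (P.z M ᵥ* NormedSpace.exp ((t - τ) • J)) j *
            (Complex.exp (-lam * τ) * (NormedSpace.exp (τ • J) *ᵥ modalVec M β) k)) :=
            Finset.sum_congr rfl fun j _ => (intervalIntegral.integral_finsetSum
              fun k _ => (hF j k).intervalIntegrable _ _).symm
        _ = ∫ τ in (0 : ℝ)..t, ∑ j, ∑ k, P.Sbar M j k *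
          (Complex.exp (-lam * (t - τ : ℝ)) * (P.z M ᵥ* NormedSpace.exp ((t - τ) • J)) j *
            (Complex.exp (-lam * τ) * (NormedSpace.exp (τ • J) *ᵥ modalVec M β) k)) :=
            (intervalIntegral.integral_finsetSum fun j _ =>
              (continuous_finsetSum _ fun k _ => hF j k).intervalIntegrable _ _).symm
        _ = _ := by
          congr 1
          funext τ
          rw [Finset.mul_sum]
          refine Finset.sum_congr rfl fun j _ => ?_
          rw [Finset.mul_sum]
          refine Finset.sum_congr rfl fun k _ => ?_
          have he : Complex.exp (-lam * t) =
              Complex.exp (-lam * (t - τ : ℝ)) * Complex.exp (-lam * τ) := by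
            rw [← Complex.exp_add]
            congr 1
            push_cast
            ring
          rw [he]
          ring

end SISOSystem

end Modal

/-! ### The main theorem. -/

theorem theorem3 {N : ℕ} (P : SISOSystem N)
    -- the vector `β = A₀⁻¹ b`, and the condition under which the gain `k₀` exists
    (β : Fin N → ℝ) (hβ : P.A₀.mulVec β = P.b) (hcβ : P.c ⬝ᵥ β ≠ 0)
    -- `lam` has algebraic multiplicity `ℓ` and geometric multiplicity `1`, and is dominant
    (ℓ : ℕ) (hℓ : 0 < ℓ) (hℓN : ℓ ≤ N) (lam : ℂ)
    (halg : P.A₀C.charpoly.rootMultiplicity lam = ℓ)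
    (hgeom : Module.finrank ℂ (Module.End.eigenspace (Matrix.toLin' P.A₀C) lam) = 1)
    (hdom : ∀ μ ∈ spectrum ℂ P.A₀C, μ ≠ lam → μ.re < lam.re)
    -- a Jordan decomposition in which `lam` comes first
    (M J : Matrix (Fin N) (Fin N) ℂ) (hM : IsUnit M.det) (hJ : IsJordanMatrix J)
    (hMJ : P.A₀C = M * J * M⁻¹) (hfirst : ∀ i : Fin N, (i : ℕ) < ℓ → J i i = lam)
    -- the denominator `z_1 w_ℓ` of the asserted asymptotics does not vanish
    (hz : P.z M ⟨0, by omega⟩ ≠ 0) (hw : modalVec M β ⟨ℓ - 1, by omega⟩ ≠ 0) :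
    -- the log-sensitivity is well defined for all large times
    (∀ t : ℝ, DifferentiableAt ℝ (fun ξ => P.err β ξ t) P.ξ₀) ∧
    (∀ᶠ t : ℝ in atTop, P.err β P.ξ₀ t ≠ 0) ∧
    ∃ (f : ℕ → ℂ) (R : ℝ → ℂ),
      (∀ t : ℝ, (P.logSens β t : ℂ) =
        (P.ξ₀ : ℂ) * ((∑ n ∈ Finset.range (ℓ + 1), f n * (t : ℂ) ^ n) /
          (P.z M ⟨0, by omega⟩ * modalVec M β ⟨ℓ - 1, by omega⟩ / ((ℓ - 1).factorial : ℂ)))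
        + R t) ∧
      Tendsto R atTop (𝓝 0) ∧
      R =O[atTop] (fun t : ℝ => t⁻¹) ∧
      -- the coefficient of the highest power
      f ℓ = P.z M ⟨0, by omega⟩ * modalVec M β ⟨ℓ - 1, by omega⟩ *
        P.Sbar M ⟨ℓ - 1, by omega⟩ ⟨0, by omega⟩ / ((2 * ℓ - 1).factorial : ℂ) ∧
      -- divergence
      (P.ξ₀ ≠ 0 → (∃ n : ℕ, 1 ≤ n ∧ n ≤ ℓ ∧ f n ≠ 0) →
        Tendsto (fun t => |P.logSens β t|) atTop atTop) := by
  have hrest : ∀ i : Fin N, ℓ ≤ (i : ℕ) → (J i i).re < lam.re := fun i hi =>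
    hdom _ (diag_mem_spectrum hM hJ hMJ i)
      (diag_ne_of_rootMultiplicity hM hJ hMJ hℓN halg hfirst i hi)
  have hsup := superdiag_eq_one hM hJ hMJ hgeom hfirst
  obtain ⟨hout, hsens⟩ := P.polyUpToDecay_scaled β hM hMJ hℓ hℓN
    (polyUpToDecay_exp_mulVec hJ hℓ hℓN hfirst hrest hsup)
  set κ := P.z M ⟨0, by omega⟩ * modalVec M β ⟨ℓ - 1, by omega⟩ with hκ
  have hκ0 : κ ≠ 0 := mul_ne_zero hz hw
  obtain ⟨hne, q, hq, hqc, hO⟩ := hout.exists_quotient hsens hκ0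
  have hfac : ((ℓ - 1).factorial : ℂ) ≠ 0 := by exact_mod_cast (ℓ - 1).factorial_ne_zero
  set κ' := κ / ((ℓ - 1).factorial : ℂ) with hκ'
  have hκ'0 : κ' ≠ 0 := div_ne_zero hκ0 hfac
  have hsum : ∀ t : ℝ, (∑ n ∈ Finset.range (ℓ + 1), q.coeff n * κ' * (t : ℂ) ^ n) / κ' =
      q.eval (t : ℂ) := by
    intro t
    rw [Polynomial.eval_eq_sum_range' (Nat.lt_succ_iff.2 hq), Finset.sum_div]
    refine Finset.sum_congr rfl fun n _ => ?_
    field_simp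
  have hRO := hO.const_mul_left (P.ξ₀ : ℂ)
  have hR := hRO.trans_tendsto tendsto_inv_atTop_zero
  -- The `f n` are the quotient's coefficients times `κ'`, which cancels the prescribed denominator.
  refine ⟨fun t => (P.hasDerivAt_err β t).differentiableAt, ?_, fun n => q.coeff n * κ',
    fun t => P.ξ₀ * (P.scaledSensitivity β lam t / P.scaledOutput β lam t - q.eval (t : ℂ)),
    fun t => ?_, hR, hRO, ?_, fun hξ ⟨n, hn1, _, hn⟩ => ?_⟩
  · filter_upwards [hne] with t ht h
    apply ht
    have hk : P.k₀ β ≠ 0 := neg_ne_zero.2 (inv_ne_zero hcβ)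
    have h' : P.c ⬝ᵥ (NormedSpace.exp (t • P.A₀)).mulVec β = 0 :=
      (mul_eq_zero.1 h).resolve_left (neg_ne_zero.2 hk)
    simp [SISOSystem.scaledOutput, h']
  · rw [hsum, P.logSens_eq β (lam := lam) hcβ]
    ring
  · beta_reduce
    rw [hqc, show ℓ - 1 + ℓ = 2 * ℓ - 1 by omega]
  · have hdeg : 0 < q.degree := by
      refine lt_of_lt_of_le ?_ (Polynomial.le_degree_of_ne_zero (left_ne_zero_of_mul hn))
      exact_mod_cast hn1
    have hpoly : Tendsto (fun t : ℝ => ‖q.eval (t : ℂ)‖) atTop atTop := by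
      refine q.tendsto_norm_atTop hdeg ?_
      simpa using tendsto_abs_atTop_atTop
    have hξ' : 0 < ‖(P.ξ₀ : ℂ)‖ := by simpa using hξ
    -- Reverse triangle inequality: the polynomial part tends to infinity in norm while the
    -- remainder tends to zero.
    refine tendsto_atTop_mono (fun t => ?_)
      ((hpoly.const_mul_atTop hξ').atTop_add hR.norm.neg)
    have h1 : (P.logSens β t : ℂ) = P.ξ₀ * q.eval (t : ℂ) +
        P.ξ₀ * (P.scaledSensitivity β lam t / P.scaledOutput β lam t - q.eval (t : ℂ)) := by
      rw [P.logSens_eq β (lam := lam) hcβ]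
      ring
    have h2 := norm_sub_le_norm_add ((P.ξ₀ : ℂ) * q.eval (t : ℂ)) (P.ξ₀ *
      (P.scaledSensitivity β lam t / P.scaledOutput β lam t - q.eval (t : ℂ)))
    rwa [← h1, norm_mul _ (q.eval _), Complex.norm_real (P.logSens β t), Real.norm_eq_abs,
      sub_eq_add_neg] at h2
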